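/- Fix $\theta\in\mathbb{R}$. Then, for all sufficiently large integers $k$ (how large may depend on $\theta$), the equation $$(z-2)^k - e^{i\theta}(z-1)^{k-1} = 0$$ has a solution $z = z_k \in \mathbb{C}$ such that $$z_k = \frac{k}{\log k - \log\log k}\left[1 + \frac{i\theta}{\log k} + O\!\left(\frac{\log\log k}{\log^2 k}\right)\right] \qquad (k\to\infty),$$ where the constant implied in the $O$-term may depend on $\theta$. -/

import Mathlib

open Filter Asymptotics

/-! With z = 1 + k/u the equation becomes (1 - u/k)^k = e^{iθ} u/k; taking logarithms and adding u
gives u = `rootMap` u. Since k log(1 - u/k) ≈ -u, the map is nearly L - iθ - log u with L = log k,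
which varies slowly near L. Banach's theorem on a disc of radius log L + |θ| + 1 about L
(`exists_rootMap_fixedPoint`) gives u = L - log L - iθ + O(log L / L), and `norm_error_le` turns
this into the expansion of z. -/

/-- A fixed point `u` of this map, with `x = k` and `L = log k`, gives the root `z = 1 + k / u`. -/
noncomputable def rootMap (θ x L : ℝ) (u : ℂ) : ℂ :=
  L - Complex.I * θ - Complex.log u + x * Complex.log (1 - u / x) + u

lemma norm_bounds_of_mem_closedBall {L R : ℝ} (hL : 0 < L) (hR : 3 * R ≤ L) {u : ℂ}
    (hu : u ∈ Metric.closedBall (L : ℂ) R) : L / 2 ≤ u.re ∧ L / 2 ≤ ‖u‖ ∧ ‖u‖ ≤ 2 * L := by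
  rw [mem_closedBall_iff_norm] at hu
  have hre : |u.re - L| ≤ R := by
    simpa using (Complex.abs_re_le_norm (u - L)).trans hu
  have h1 := (abs_le.mp hre).1
  have h2 : L / 2 ≤ u.re := by linarith
  refine ⟨h2, h2.trans (Complex.re_le_norm u), ?_⟩
  have h3 : ‖u‖ ≤ ‖u - L‖ + ‖(L : ℂ)‖ := by simpa using norm_add_le (u - L) (L : ℂ)
  rw [Complex.norm_real, Real.norm_of_nonneg hL.le] at h3
  linarith

lemma norm_div_le_half {L x : ℝ} (hL : 12 ≤ L) (hx : L ^ 3 ≤ x) {u : ℂ} (hu : ‖u‖ ≤ 2 * L) :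
    ‖u / x‖ ≤ 2 * L / x ∧ 2 * L / x ≤ 1 / 2 ∧ 4 * L / x ≤ 1 / L := by
  have hL0 : 0 < L := by linarith
  have hx0 : 0 < x := lt_of_lt_of_le (by positivity) hx
  refine ⟨?_, ?_, ?_⟩
  · rw [norm_div, Complex.norm_real, Real.norm_of_nonneg hx0.le]
    gcongr
  · rw [div_le_div_iff₀ hx0 two_pos]
    nlinarith [mul_le_mul hL hL (by norm_num) hL0.le]
  · rw [div_le_div_iff₀ hx0 hL0]
    nlinarith [mul_nonneg (sq_nonneg L) (sub_nonneg.mpr hL)]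

lemma norm_rootMap_sub_le {θ x L R : ℝ} (hL : 12 ≤ L) (hx : L ^ 3 ≤ x) (hR : 3 * R ≤ L) {u v : ℂ}
    (hu : u ∈ Metric.closedBall (L : ℂ) R) (hv : v ∈ Metric.closedBall (L : ℂ) R) :
    ‖rootMap θ x L u - rootMap θ x L v‖ ≤ 3 / L * ‖u - v‖ := by
  have hL0 : 0 < L := by linarith
  have hx0 : 0 < x := lt_of_lt_of_le (by positivity) hx
  have hxc : (x : ℂ) ≠ 0 := by exact_mod_cast hx0.ne'
  refine Convex.norm_image_sub_le_of_norm_hasDerivWithin_le (𝕜 := ℂ) (s := Metric.closedBall (L : ℂ) R)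
    (f' := fun u => -(1 / u) + x * (-(1 / x) / (1 - u / x)) + 1) ?_ ?_ (convex_closedBall _ _) hv hu
  · intro w hw
    obtain ⟨hre, -, hn⟩ := norm_bounds_of_mem_closedBall hL0 hR hw
    obtain ⟨h1, h2, -⟩ := norm_div_le_half hL hx hn
    have hs : w ∈ Complex.slitPlane := Or.inl (by linarith)
    have hs' : 1 - w / x ∈ Complex.slitPlane := by
      refine Or.inl ?_
      have := (Complex.re_le_norm (w / x)).trans (h1.trans h2)
      rw [Complex.sub_re, Complex.one_re]
      linarith
    have hd : HasDerivAt (fun u : ℂ => 1 - u / x) (-(1 / x)) w := by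
      simpa using ((hasDerivAt_id w).div_const (x : ℂ)).const_sub 1
    have := ((((hasDerivAt_id w).clog hs).const_sub ((L : ℂ) - Complex.I * θ)).add
      ((hd.clog hs').const_mul (x : ℂ))).add (hasDerivAt_id w)
    exact this.hasDerivWithinAt
  · intro w hw
    obtain ⟨-, hlo, hn⟩ := norm_bounds_of_mem_closedBall hL0 hR hw
    obtain ⟨h1, h2, h3⟩ := norm_div_le_half hL hx hn
    have hge : 1 / 2 ≤ ‖1 - w / x‖ := by
      have := norm_sub_norm_le (1 : ℂ) (w / x)
      rw [norm_one] at this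
      linarith
    have hne : 1 - w / (x : ℂ) ≠ 0 := norm_pos_iff.mp (by linarith)
    -- The added `u` cancels the derivative -1 of the leading part of x log(1 - w/x); only terms of
    -- size O(1/L) remain.
    have heq : -(1 / w) + x * (-(1 / x) / (1 - w / x)) + 1 = -(1 / w) - w / x / (1 - w / x) := by
      have : (x : ℂ) * (-(1 / x) / (1 - w / x)) = -(1 / (1 - w / x)) := by
        rw [← mul_div_assoc, mul_neg, mul_one_div_cancel hxc, neg_div]
      rw [this]
      have h4 : (1 : ℂ) = (1 - w / x) / (1 - w / x) := (div_self hne).symm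
      calc _ = -(1 / w) - 1 / (1 - w / x) + (1 - w / x) / (1 - w / x) := by rw [← h4]; ring
        _ = _ := by ring
    rw [heq]
    calc _ ≤ ‖-(1 / w)‖ + ‖w / x / (1 - w / x)‖ := norm_sub_le _ _
      _ ≤ 1 / (L / 2) + 2 * L / x / (1 / 2) := by
        rw [norm_neg, norm_div, norm_one, norm_div (w / x)]
        gcongr
      _ = 2 / L + 4 * L / x := by ring
      _ ≤ 2 / L + 1 / L := by gcongr
      _ = 3 / L := by ring

lemma norm_rootMap_center_sub_le {θ x L : ℝ} (hL : 12 ≤ L) (hx : L ^ 3 ≤ x) :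
    ‖rootMap θ x L L - (L - Real.log L - Complex.I * θ)‖ ≤ 1 / L := by
  have hL0 : 0 < L := by linarith
  have hx0 : 0 < x := lt_of_lt_of_le (by positivity) hx
  have hxc : (x : ℂ) ≠ 0 := by exact_mod_cast hx0.ne'
  obtain ⟨-, h2, -⟩ := norm_div_le_half (u := 0) hL hx (by simpa using hL0.le)
  have hn : ‖-((L : ℂ) / x)‖ = L / x := by
    rw [norm_neg, norm_div, Complex.norm_real, Complex.norm_real, Real.norm_of_nonneg hL0.le,
      Real.norm_of_nonneg hx0.le]
  have h4 : L / x ≤ 1 / 2 := by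
    have : 0 < L / x := by positivity
    have : 2 * L / x = 2 * (L / x) := by ring
    linarith
  -- The quadratic Taylor remainder, multiplied by x, is at most L²/x, hence the cubic hypothesis on
  -- x.
  have key := Complex.norm_log_one_add_sub_self_le (z := -((L : ℂ) / x)) (by rw [hn]; linarith)
  rw [hn] at key
  have heq : rootMap θ x L L - (L - Real.log L - Complex.I * θ) =
      x * (Complex.log (1 + -((L : ℂ) / x)) - -((L : ℂ) / x)) := by
    rw [rootMap, ← Complex.ofReal_log hL0.le, ← sub_eq_add_neg, mul_sub, mul_neg,
      mul_div_cancel₀ _ hxc]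
    ring
  rw [heq, norm_mul, Complex.norm_real, Real.norm_of_nonneg hx0.le]
  have hinv : (1 - L / x)⁻¹ ≤ 2 := by
    rw [inv_le_comm₀ (by linarith) two_pos]
    linarith
  calc _ ≤ x * ((L / x) ^ 2 * (1 - L / x)⁻¹ / 2) := by gcongr
    _ ≤ x * ((L / x) ^ 2 * 2 / 2) := by gcongr
    _ = L ^ 2 / x := by field_simp
    _ ≤ 1 / L := by
      rw [div_le_div_iff₀ hx0 hL0]
      linarith

lemma exists_rootMap_fixedPoint {θ x L : ℝ} (hL : 12 ≤ L) (hx : L ^ 3 ≤ x)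
    (hlog : 3 * (Real.log L + |θ| + 1) + 1 ≤ L) :
    ∃ u ∈ Metric.closedBall (L : ℂ) (Real.log L + |θ| + 1), rootMap θ x L u = u ∧
      ‖u - (L - Real.log L - Complex.I * θ)‖ ≤ (3 * (Real.log L + |θ| + 1) + 1) / L := by
  have hL0 : 0 < L := by linarith
  have hM : 0 ≤ Real.log L := Real.log_nonneg (by linarith)
  set R := Real.log L + |θ| + 1 with hRdef
  have hR0 : 0 ≤ R := by positivity
  set a : ℂ := L - Real.log L - Complex.I * θ with ha
  have hcen : (L : ℂ) ∈ Metric.closedBall (L : ℂ) R := Metric.mem_closedBall_self hR0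
  have hclose : ∀ u ∈ Metric.closedBall (L : ℂ) R, ‖rootMap θ x L u - a‖ ≤ (3 * R + 1) / L := by
    intro u hu
    have h1 := norm_rootMap_sub_le (θ := θ) hL hx (by linarith) hu hcen
    have h2 := norm_rootMap_center_sub_le (θ := θ) hL hx
    have h3 := norm_sub_le_norm_sub_add_norm_sub (rootMap θ x L u) (rootMap θ x L L) a
    calc _ ≤ 3 / L * ‖u - L‖ + 1 / L := by linarith
      _ ≤ 3 / L * R + 1 / L := by
        gcongr
        exact mem_closedBall_iff_norm.mp hu
      _ = _ := by ring
  have hmaps : Set.MapsTo (rootMap θ x L) (Metric.closedBall (L : ℂ) R)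
      (Metric.closedBall (L : ℂ) R) := by
    intro u hu
    rw [mem_closedBall_iff_norm]
    have h1 : ‖rootMap θ x L u - a‖ ≤ 1 := (hclose u hu).trans ((div_le_one hL0).mpr hlog)
    have h2 : ‖a - L‖ ≤ Real.log L + |θ| := by
      have : a - L = -(Real.log L : ℂ) - Complex.I * θ := by rw [ha]; ring
      rw [this]
      refine (norm_sub_le _ _).trans_eq ?_
      rw [norm_neg, norm_mul, Complex.norm_I, one_mul, Complex.norm_real, Complex.norm_real,
        Real.norm_of_nonneg hM, Real.norm_eq_abs]
    have h3 := norm_sub_le_norm_sub_add_norm_sub (rootMap θ x L u) a (L : ℂ)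
    linarith
  have hcontr : ContractingWith (1 / 2) (hmaps.restrict (rootMap θ x L) _ _) := by
    refine ⟨by rw [← NNReal.coe_lt_coe]; norm_num, LipschitzWith.of_dist_le_mul ?_⟩
    rintro ⟨u, hu⟩ ⟨v, hv⟩
    have h1 := norm_rootMap_sub_le (θ := θ) hL hx (by linarith) hu hv
    have h2 : 3 / L ≤ 1 / 2 := by
      rw [div_le_div_iff₀ hL0 two_pos]
      linarith
    rw [Subtype.dist_eq, Subtype.dist_eq]
    simp only [Set.MapsTo.val_restrict_apply, dist_eq_norm]
    refine h1.trans ?_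
    push_cast
    gcongr
  obtain ⟨u, hu, hfix, -⟩ := hcontr.exists_fixedPoint' Metric.isClosed_closedBall.isComplete hmaps
    hcen (edist_ne_top _ _)
  exact ⟨u, hu, hfix, by simpa only [hfix.eq] using hclose u hu⟩

lemma root_of_rootMap_fixedPoint {θ : ℝ} {k : ℕ} (hk : k ≠ 0) {u : ℂ} (hu : u ≠ 0)
    (hne : 1 - u / k ≠ 0) (hfix : rootMap θ k (Real.log k) u = u) :
    (1 + k / u - 2) ^ k - Complex.exp (Complex.I * θ) * (1 + k / u - 1) ^ (k - 1) = 0 := by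
  have hkc : (k : ℂ) ≠ 0 := by exact_mod_cast hk
  have hlog : (k : ℂ) * Complex.log (1 - u / k) =
      Complex.log u + Complex.I * θ - Complex.log k := by
    rw [rootMap, Complex.ofReal_log (Nat.cast_nonneg k), Complex.ofReal_natCast] at hfix
    linear_combination hfix
  have hpow : (1 - u / k) ^ k = u * Complex.exp (Complex.I * θ) / k := by
    rw [← Complex.exp_log hne, ← Complex.exp_nat_mul, hlog,
      Complex.exp_sub, Complex.exp_add, Complex.exp_log hu, Complex.exp_log hkc]
  have hw : 1 + (k : ℂ) / u - 2 = k / u * (1 - u / k) := by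
    field_simp
    ring
  obtain ⟨n, rfl⟩ := Nat.exists_eq_succ_of_ne_zero hk
  rw [hw, mul_pow, hpow, add_sub_cancel_left, Nat.succ_sub_one, pow_succ]
  field_simp
  ring

lemma norm_error_le {θ x L M : ℝ} {u : ℂ} (hL : 12 ≤ L) (hx : L ^ 3 ≤ x) (hM : |θ| + 1 ≤ M)
    (hML : M ≤ L) (hlo : L / 2 ≤ ‖u‖) (hball : ‖u - L‖ ≤ 2 * M)
    (hu : ‖u - (L - M - Complex.I * θ)‖ ≤ 7 * M / L) :
    ‖(L - M) / x + (L - M) / u - 1 - Complex.I * θ / L‖ ≤ (15 + 4 * |θ|) * (M / L ^ 2) := by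
  have hL0 : 0 < L := by linarith
  have hx0 : 0 < x := lt_of_lt_of_le (by positivity) hx
  have hM1 : 1 ≤ M := by linarith [abs_nonneg θ]
  have hLc : (L : ℂ) ≠ 0 := by exact_mod_cast hL0.ne'
  have hu0 : u ≠ 0 := norm_pos_iff.mp (by linarith)
  -- The three errors come from the summand 1 in z = 1 + x/u, the approximation of u, and replacing
  -- iθ/u by iθ/L.
  have heq : (L - M) / x + (L - M) / u - 1 - Complex.I * θ / L =
      ((L - M : ℝ) : ℂ) / x - (u - (L - M - Complex.I * θ)) / u
        - Complex.I * θ * (u - L) / (u * L) := by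
    push_cast
    field_simp
    ring
  rw [heq]
  have h1 : ‖((L - M : ℝ) : ℂ) / x‖ ≤ M / L ^ 2 := by
    rw [norm_div, Complex.norm_real, Complex.norm_real, Real.norm_of_nonneg hx0.le,
      Real.norm_of_nonneg (by linarith), div_le_div_iff₀ hx0 (by positivity)]
    calc (L - M) * L ^ 2 ≤ L * L ^ 2 := by gcongr; linarith
      _ = L ^ 3 := by ring
      _ ≤ x := hx
      _ ≤ M * x := by nlinarith
  have h2 : ‖(u - (L - M - Complex.I * θ)) / u‖ ≤ 14 * (M / L ^ 2) := by
    rw [norm_div]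
    calc _ ≤ (7 * M / L) / (L / 2) := by gcongr
      _ = _ := by field_simp; norm_num
  have h3 : ‖Complex.I * θ * (u - L) / (u * L)‖ ≤ 4 * |θ| * (M / L ^ 2) := by
    rw [norm_div, norm_mul, norm_mul, norm_mul, Complex.norm_I, one_mul, Complex.norm_real,
      Complex.norm_real, Real.norm_of_nonneg hL0.le, Real.norm_eq_abs]
    calc _ ≤ |θ| * (2 * M) / (L / 2 * L) := by gcongr
      _ = _ := by field_simp; norm_num
  calc _ ≤ _ := (norm_sub_le _ _).trans (add_le_add_left (norm_sub_le _ _) _)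
    _ ≤ M / L ^ 2 + 14 * (M / L ^ 2) + 4 * |θ| * (M / L ^ 2) := by gcongr
    _ = _ := by ring

lemma exists_root_of_large {θ : ℝ} {k : ℕ} (hL : 12 ≤ Real.log k) (hk : Real.log k ^ 3 ≤ k)
    (hM : |θ| + 1 ≤ Real.log (Real.log k))
    (hlog : 3 * (Real.log (Real.log k) + |θ| + 1) + 1 ≤ Real.log k) :
    ∃ z ε : ℂ, ‖ε‖ ≤ (15 + 4 * |θ|) * (Real.log (Real.log k) / Real.log k ^ 2) ∧
      (z - 2) ^ k - Complex.exp (Complex.I * θ) * (z - 1) ^ (k - 1) = 0 ∧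
      z = k / ((Real.log k - Real.log (Real.log k) : ℝ) : ℂ) *
        (1 + Complex.I * θ / (Real.log k : ℂ) + ε) := by
  obtain ⟨u, hu, hfix, hclose⟩ := exists_rootMap_fixedPoint hL hk hlog
  have hθ := abs_nonneg θ
  set L := Real.log k with hLdef
  set M := Real.log L with hMdef
  have hL0 : 0 < L := by linarith
  have hk0 : (0 : ℝ) < k := lt_of_lt_of_le (by positivity) hk
  have hkn : k ≠ 0 := by exact_mod_cast hk0.ne'
  have hkc : (k : ℂ) ≠ 0 := by exact_mod_cast hkn
  obtain ⟨-, hlo, hhi⟩ := norm_bounds_of_mem_closedBall hL0 (by linarith) hu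
  obtain ⟨h1, h2, -⟩ := norm_div_le_half hL hk hhi
  rw [Complex.ofReal_natCast] at h1
  have hu0 : u ≠ 0 := norm_pos_iff.mp (by linarith)
  have hne : 1 - u / k ≠ 0 := by
    intro h
    rw [← sub_eq_zero.mp h, norm_one] at h1
    linarith
  refine ⟨1 + k / u, (L - M) / k + (L - M) / u - 1 - Complex.I * θ / L, ?_,
    root_of_rootMap_fixedPoint hkn hu0 hne hfix, ?_⟩
  · rw [mem_closedBall_iff_norm] at hu
    -- As |θ| + 1 ≤ M and M ≥ 1, 3(M + |θ| + 1) + 1 ≤ 7M.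
    have := norm_error_le (x := k) hL hk hM (by linarith) hlo (by linarith) (hclose.trans (by
      gcongr
      linarith))
    simpa only [Complex.ofReal_natCast] using this
  · have hm : (L : ℂ) - M ≠ 0 := by
      rw [← Complex.ofReal_sub]
      exact_mod_cast (by linarith : 0 < L - M).ne'
    push_cast
    field_simp
    ring

theorem theorem5p1 (θ : ℝ) :
    ∃ z ε : ℕ → ℂ,
      (ε =O[atTop] fun k : ℕ => Real.log (Real.log (k : ℝ)) / Real.log (k : ℝ) ^ 2) ∧
      ∀ᶠ k : ℕ in atTop,
        (z k - 2) ^ k - Complex.exp (Complex.I * (θ : ℂ)) * (z k - 1) ^ (k - 1) = 0 ∧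
        z k = ((k : ℂ) / ((Real.log (k : ℝ) - Real.log (Real.log (k : ℝ)) : ℝ) : ℂ)) *
          (1 + Complex.I * (θ : ℂ) / ((Real.log (k : ℝ) : ℝ) : ℂ) + ε k) := by
  have hcast : Tendsto (fun k : ℕ => (k : ℝ)) atTop atTop := tendsto_natCast_atTop_atTop
  have hlogk := Real.tendsto_log_atTop.comp hcast
  have e1 := hlogk.eventually_ge_atTop 12
  have e2 : ∀ᶠ k : ℕ in atTop, Real.log k ^ 3 ≤ k := by
    filter_upwards [hcast.eventually ((Real.isLittleO_pow_log_id_atTop (n := 3)).bound one_pos)]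
      with k hk
    rw [one_mul, id, Real.norm_of_nonneg (Nat.cast_nonneg k)] at hk
    exact (le_abs_self _).trans hk
  have e3 := (Real.tendsto_log_atTop.comp hlogk).eventually_ge_atTop (|θ| + 1)
  have e4 : ∀ᶠ k : ℕ in atTop,
      3 * (Real.log (Real.log k) + |θ| + 1) + 1 ≤ Real.log k := by
    -- With log L ≤ L/12 and |θ| + 1 ≤ log L, the left side is at most L/2 + 1.
    filter_upwards [hlogk.eventually (Real.isLittleO_log_id_atTop.bound
      (show (0 : ℝ) < 1 / 12 by norm_num)), e1, e3] with k hk h1 h3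
    simp only [Function.comp_apply, id] at hk h1 h3
    rw [Real.norm_of_nonneg (by linarith : 0 ≤ Real.log (k : ℝ))] at hk
    have := (le_abs_self _).trans hk
    linarith
  have hex : ∀ᶠ k : ℕ in atTop, ∃ p : ℂ × ℂ,
      ‖p.2‖ ≤ (15 + 4 * |θ|) * (Real.log (Real.log k) / Real.log k ^ 2) ∧
      (p.1 - 2) ^ k - Complex.exp (Complex.I * θ) * (p.1 - 1) ^ (k - 1) = 0 ∧
      p.1 = k / ((Real.log k - Real.log (Real.log k) : ℝ) : ℂ) *
        (1 + Complex.I * θ / (Real.log k : ℂ) + p.2) := by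
    filter_upwards [e1, e2, e3, e4] with k h1 h2 h3 h4
    obtain ⟨z, ε, h⟩ := exists_root_of_large h1 h2 h3 h4
    exact ⟨(z, ε), h⟩
  obtain ⟨p, hp⟩ := hex.choice
  refine ⟨fun k => (p k).1, fun k => (p k).2, ?_, hp.mono fun k hk => hk.2⟩
  refine IsBigO.of_bound (15 + 4 * |θ|) (hp.mono fun k hk => hk.1.trans ?_)
  gcongr
  exact le_abs_self _
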